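/- Let $(W,S)$ be a Coxeter system with $S$ finite and $W$ infinite, and let $\Delta$ be a locally finite building of type $(W,S)$ (every panel contains only finitely many chambers). Let $|\Delta|$ be the Davis realization of $\Delta$, that is, the geometric realization of the poset (ordered by inclusion) of the spherical residues of $\Delta$. A group acting on a topological space $Y$ is said to act co-compactly if $Y$ is the union of the translates of some compact subset of $Y$. Let $G$ be a (not necessarily discrete) group of type-preserving automorphisms of $\Delta$ that acts co-compactly on $|\Delta|$. Let $\mathbf{c}$ be a chamber of $\Delta$, let $\mathcal{R}$ be any residue of $\Delta$ containing $\mathbf{c}$, and let $\mathrm{Stab}_G(\mathcal{R})=\{g\in G : g\mathcal{R}=\mathcal{R}\}$. Then $\mathrm{Stab}_G(\mathcal{R})$ preserves and acts co-compactly on $\mathcal{R}$, in both geometric senses: it acts co-compactly on the Davis realization $|\mathcal{R}|\subseteq|\Delta|$ of $\mathcal{R}$ (the subcomplex spanned by the spherical residues contained in $\mathcal{R}$), and it acts co-compactly on the union of the closed chambers of $|\Delta|$ that belong to the chambers of $\mathcal{R}$, where the closed chamber belonging to $d$ is the subcomplex spanned by the spherical residues containing $d$. -/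

import Mathlib

open scoped Pointwise

/-- The standard parabolic subgroup `W_J` generated by the simple reflections in `J ⊆ S`. -/
def CoxeterSystem.parabolic {B W : Type*} [Group W] {M : CoxeterMatrix B}
    (cs : CoxeterSystem M W) (J : Set B) : Subgroup W :=
  Subgroup.closure (cs.simple '' J)

/-- A building of type `(W, S)` with set of chambers `C`, given by its Weyl distance.
The simple reflections are indexed by `B`, i.e. `S = {cs.simple s | s : B}`. -/
structure Building {B W : Type*} [Group W] {M : CoxeterMatrix B}
    (cs : CoxeterSystem M W) (C : Type*) where
  /-- the Weyl distance -/
  dist : C → C → W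
  dist_eq_one_iff : ∀ c d, dist c d = 1 ↔ c = d
  dist_of_adj : ∀ (s : B) (c' c d : C), dist c' c = cs.simple s →
    dist c' d = cs.simple s * dist c d ∨ dist c' d = dist c d
  dist_of_adj_of_length : ∀ (s : B) (c' c d : C), dist c' c = cs.simple s →
    cs.length (cs.simple s * dist c d) = cs.length (dist c d) + 1 →
    dist c' d = cs.simple s * dist c d
  exists_adj : ∀ (s : B) (c d : C), ∃ c', dist c' c = cs.simple s ∧
    dist c' d = cs.simple s * dist c d

namespace Building

variable {B W C : Type*} [Group W] {M : CoxeterMatrix B} {cs : CoxeterSystem M W}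

/-- The residue of type `J` containing the chamber `c`. -/
def residue (Δ : Building cs C) (J : Set B) (c : C) : Set C :=
  {d | Δ.dist c d ∈ cs.parabolic J}

/-- `R` is a residue of some type `J ⊆ S`. -/
def IsResidue (Δ : Building cs C) (R : Set C) : Prop :=
  ∃ (J : Set B) (c : C), R = Δ.residue J c

/-- `R` is a spherical residue: a residue of some type `J` for which `W_J` is finite. -/
def IsSphericalResidue (Δ : Building cs C) (R : Set C) : Prop :=
  ∃ (J : Set B) (c : C), Finite (cs.parabolic J) ∧ R = Δ.residue J c

/-- Local finiteness: every panel (residue of type `{s}`) has finitely many chambers. -/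
def IsLocallyFinite (Δ : Building cs C) : Prop :=
  ∀ (s : B) (c : C), (Δ.residue {s} c).Finite

/-- The group of type-preserving automorphisms: the permutations of the chambers that
preserve the Weyl distance. -/
def typeAut (Δ : Building cs C) : Subgroup (Equiv.Perm C) where
  carrier := {g | ∀ c d, Δ.dist (g c) (g d) = Δ.dist c d}
  one_mem' := fun _ _ => rfl
  mul_mem' := fun {g h} hg hh c d => (hg (h c) (h d)).trans (hh c d)
  inv_mem' := fun {g} hg c d => by
    have h := hg (g⁻¹ c) (g⁻¹ d)
    simpa using h.symm

theorem smul_residue (Δ : Building cs C) (g : Δ.typeAut) (J : Set B) (c : C) :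
    g • Δ.residue J c = Δ.residue J (g • c) := by
  ext d
  have h : Δ.dist (g • c) d = Δ.dist c (g⁻¹ • d) := by
    have := g.2 c (g⁻¹ • d)
    rw [← this]
    change _ = Δ.dist (g • c) (g • g⁻¹ • d)
    rw [smul_inv_smul]
  rw [Set.mem_smul_set_iff_inv_smul_mem]
  simp only [residue, Set.mem_ofPred_eq, h]

/-- The spherical residues of the building, ordered by inclusion; they are the vertices of
the Davis realization. -/
def SphericalResidue (Δ : Building cs C) : Type _ := {A : Set C // Δ.IsSphericalResidue A}

instance (Δ : Building cs C) : MulAction Δ.typeAut Δ.SphericalResidue where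
  smul g A := ⟨g • A.1, by
    obtain ⟨J, c, hJ, h⟩ := A.2
    exact ⟨J, g • c, hJ, by rw [h, smul_residue]⟩⟩
  one_smul A := Subtype.ext (one_smul _ A.1)
  mul_smul g h A := Subtype.ext (mul_smul g h A.1)

/-- The Davis realization of the building: the geometric realization of the poset of
spherical residues. A point is given by its barycentric coordinates, which are nonnegative,
sum to `1`, and are supported on a finite chain of spherical residues. -/
def Davis (Δ : Building cs C) : Type _ :=
  {p : Δ.SphericalResidue → ℝ //
    (∀ A, 0 ≤ p A) ∧ p.support.Finite ∧ IsChain (fun A A' => A.1 ⊆ A'.1) p.support ∧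
      ∑ᶠ A, p A = 1}

/-- The topology of convergence of each barycentric coordinate. Since the coordinates are
nonnegative with sum `1`, this is the topology of the metric `∑ |p A - q A|`. On a locally finite
complex, such as the Davis realization of a locally finite building of finite rank, it
coincides with the weak topology and with the topology of the `CAT(0)` metric. -/
instance (Δ : Building cs C) : TopologicalSpace Δ.Davis :=
  TopologicalSpace.induced (fun p => p.1) Pi.topologicalSpace

/-- The simplicial action of the type-preserving automorphisms on the Davis realization. -/
instance (Δ : Building cs C) : MulAction Δ.typeAut Δ.Davis where
  smul g p := ⟨fun A => p.1 (g⁻¹ • A), by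
    obtain ⟨h0, hf, hc, h1⟩ := p.2
    refine ⟨fun A => h0 _, ?_, ?_, ?_⟩
    · exact hf.preimage (MulAction.injective g⁻¹).injOn
    · intro A hA A' hA' hne
      have h := hc (x := g⁻¹ • A) hA (y := g⁻¹ • A') hA'
        (fun h => hne (MulAction.injective g⁻¹ h))
      exact h.imp (fun h => Set.smul_set_subset_smul_set_iff.1 h)
        (fun h => Set.smul_set_subset_smul_set_iff.1 h)
    · exact (finsum_comp_equiv (MulAction.toPerm g⁻¹)).trans h1⟩
  one_smul p := Subtype.ext (funext fun A => congrArg p.1 (by rw [inv_one, one_smul]))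
  mul_smul g h p := Subtype.ext (funext fun A => congrArg p.1 (by rw [mul_inv_rev, mul_smul]))

/-- For a residue `R`, the Davis realization of `R` (a building in its own right), as a
subcomplex of the Davis realization of `Δ`: the points that are supported on spherical residues
contained in `R`. -/
def davisOf (Δ : Building cs C) (R : Set C) : Set Δ.Davis :=
  {p | ∀ A, p.1 A ≠ 0 → A.1 ⊆ R}

/-- The closed chamber of the Davis realization that belongs to the chamber `c`: the points
supported on spherical residues that contain `c`. -/
def closedChamber (Δ : Building cs C) (c : C) : Set Δ.Davis :=
  {p | ∀ A, p.1 A ≠ 0 → c ∈ A.1}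

end Building

/-- The subgroup `H` preserves the subset `Y` of the space `X` and acts co-compactly on it:
`Y` is the union of the `H`-translates of a compact subset of `Y`. -/
def ActsCocompactly {Γ X : Type*} [Group Γ] [MulAction Γ X] [TopologicalSpace X]
    (H : Subgroup Γ) (Y : Set X) : Prop :=
  (∀ h ∈ H, h • Y = Y) ∧ ∃ K ⊆ Y, IsCompact K ∧ Y = ⋃ h ∈ H, h • K

/-! Cocompactness is turned into a count of chamber orbits. A compact subset of the Davis
realization contains only finitely many vertices, so `G` has finitely many orbits of chambers
(`exists_finite_chamber_reps`). If `g` in `G` carries one chamber of `R` to another, it stabilizes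
`R`: it preserves types, and residues of one type partition the chambers (`IsResidue.smul_eq`).
Hence the stabilizer has finitely many orbits on the chambers of `R`. The closed chambers of orbit
representatives are compact, and their finite union, cut down to the realization of `R` where
needed, is the required compact set (`actsCocompactly_of_reps`). -/

namespace Building

variable {B W C : Type*} [Group W] {M : CoxeterMatrix B} {cs : CoxeterSystem M W}

/-! ### Residues of a fixed type partition the chambers -/

theorem dist_mem_parabolic_iff_of_adj (Δ : Building cs C) {J : Set B} {s : B} (hs : s ∈ J)
    {c' c : C} (h : Δ.dist c' c = cs.simple s) (e : C) :
    Δ.dist c' e ∈ cs.parabolic J ↔ Δ.dist c e ∈ cs.parabolic J := by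
  have hsJ : cs.simple s ∈ cs.parabolic J := Subgroup.subset_closure ⟨s, hs, rfl⟩
  rcases Δ.dist_of_adj s c' c e h with h | h
  · rw [h, Subgroup.mul_mem_cancel_left _ hsJ]
  · rw [h]

/-- Walk from `c` to `d` along a word in `J`: `exists_adj` supplies the next chamber, and each step
between adjacent chambers preserves membership. -/
theorem dist_mem_parabolic_iff (Δ : Building cs C) {J : Set B} {c d : C}
    (h : Δ.dist c d ∈ cs.parabolic J) (e : C) :
    Δ.dist c e ∈ cs.parabolic J ↔ Δ.dist d e ∈ cs.parabolic J := by
  have step : ∀ s ∈ J, ∀ w : W,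
      (∀ c, Δ.dist c d = w → (Δ.dist c e ∈ cs.parabolic J ↔ Δ.dist d e ∈ cs.parabolic J)) →
      ∀ c, Δ.dist c d = cs.simple s * w →
        (Δ.dist c e ∈ cs.parabolic J ↔ Δ.dist d e ∈ cs.parabolic J) := by
    intro s hs w ih c hc
    obtain ⟨c', h1, h2⟩ := Δ.exists_adj s c d
    rw [hc, cs.simple_mul_simple_cancel_left] at h2
    rw [← Δ.dist_mem_parabolic_iff_of_adj hs h1, ih c' h2]
  obtain ⟨w, hw⟩ : ∃ w, Δ.dist c d = w := ⟨_, rfl⟩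
  rw [hw] at h
  induction h using Subgroup.closure_induction_left generalizing c with
  | one => rw [(Δ.dist_eq_one_iff c d).1 hw]
  | mul_left x hx y hy ih =>
    obtain ⟨s, hs, rfl⟩ := hx
    exact step s hs y (fun c hc => ih hc) c hw
  | inv_mul_cancel x hx y hy ih =>
    obtain ⟨s, hs, rfl⟩ := hx
    rw [cs.inv_simple] at hw
    exact step s hs y (fun c hc => ih hc) c hw

theorem residue_eq_of_mem (Δ : Building cs C) {J : Set B} {c d : C} (h : d ∈ Δ.residue J c) :
    Δ.residue J c = Δ.residue J d :=
  Set.ext fun e => Δ.dist_mem_parabolic_iff h e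

theorem mem_residue_self (Δ : Building cs C) (J : Set B) (c : C) : c ∈ Δ.residue J c := by
  change Δ.dist c c ∈ cs.parabolic J
  rw [(Δ.dist_eq_one_iff c c).2 rfl]
  exact one_mem (cs.parabolic J)

/-- An automorphism that maps one chamber of a residue into the residue stabilizes it. -/
theorem IsResidue.smul_eq {Δ : Building cs C} {R : Set C} (hR : Δ.IsResidue R)
    {g : Δ.typeAut} {c : C} (hc : c ∈ R) (hgc : g • c ∈ R) : g • R = R := by
  obtain ⟨J, c₀, rfl⟩ := hR
  conv_lhs => rw [Δ.residue_eq_of_mem hc, smul_residue]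
  rw [Δ.residue_eq_of_mem hgc]

/-- A residue through `c` is determined by its type, a subset of the finite set `B`. -/
theorem finite_sphericalResidue_containing [Finite B] (Δ : Building cs C) (c : C) :
    {A : Δ.SphericalResidue | c ∈ A.1}.Finite := by
  refine Set.Finite.of_finite_image (f := Subtype.val) ?_ Subtype.val_injective.injOn
  refine (Set.finite_range fun J : Set B => Δ.residue J c).subset ?_
  rintro _ ⟨A, hA, rfl⟩
  obtain ⟨J, d, -, h⟩ := A.2
  refine ⟨J, ?_⟩
  change c ∈ A.1 at hA
  rw [h] at hA ⊢
  exact (Δ.residue_eq_of_mem hA).symm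

/-! ### Topology of the Davis realization and its subcomplexes -/

theorem isInducing_davis (Δ : Building cs C) :
    Topology.IsInducing (fun p : Δ.Davis => p.1) := ⟨rfl⟩

theorem continuous_coord (Δ : Building cs C) (A : Δ.SphericalResidue) :
    Continuous fun p : Δ.Davis => p.1 A :=
  (continuous_apply A).comp Δ.isInducing_davis.continuous

theorem isCompact_closedChamber [Finite B] (Δ : Building cs C) (c : C) :
    IsCompact (Δ.closedChamber c) := by
  classical
  have hF := Δ.finite_sphericalResidue_containing c
  rw [Δ.isInducing_davis.isCompact_iff]
  -- All supports lie in one finite set, so the sum is continuous; the chain condition becomes the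
  -- vanishing of products. These are closed conditions inside the compact cube.
  have himage : (fun p : Δ.Davis => p.1) '' Δ.closedChamber c =
      {f | (∀ A, 0 ≤ f A) ∧ (∀ A, c ∉ A.1 → f A = 0) ∧
        (∀ A A', ¬(A.1 ⊆ A'.1 ∨ A'.1 ⊆ A.1) → f A * f A' = 0) ∧
        ∑ A ∈ hF.toFinset, f A = 1} := by
    ext f
    constructor
    · rintro ⟨⟨f, h0, _, hch, h1⟩, hp, rfl⟩
      refine ⟨h0, fun A hA => by_contra fun h => hA (hp A h), fun A A' hAA' => ?_, ?_⟩
      · by_contra h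
        obtain ⟨hA, hA'⟩ := mul_ne_zero_iff.1 h
        refine hAA' (hch hA hA' ?_)
        rintro rfl
        exact hAA' (Or.inl subset_rfl)
      · refine (finsum_eq_sum_of_support_subset f fun A hA => ?_).symm.trans h1
        simpa using hp A hA
    · rintro ⟨h0, hs, hch, h1⟩
      have hsub : f.support ⊆ {A : Δ.SphericalResidue | c ∈ A.1} :=
        fun A hA => by_contra fun h => hA (hs A h)
      refine ⟨⟨f, h0, hF.subset hsub, ?_, ?_⟩, fun A hA => hsub hA, rfl⟩
      · intro A hA A' hA' _
        by_contra h
        exact mul_ne_zero hA hA' (hch A A' h)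
      · rw [← h1, finsum_eq_sum_of_support_subset]
        simpa using hsub
  rw [himage]
  refine (isCompact_univ_pi fun _ => isCompact_Icc (a := (0 : ℝ)) (b := 1)).of_isClosed_subset
    ?_ ?_
  · simp only [Set.ofPred_and, Set.ofPred_forall]
    refine IsClosed.inter ?_ (IsClosed.inter ?_ (IsClosed.inter ?_ ?_))
    · exact isClosed_iInter fun A => isClosed_le continuous_const (continuous_apply A)
    · exact isClosed_iInter fun A => isClosed_iInter fun _ =>
        isClosed_eq (continuous_apply A) continuous_const
    · exact isClosed_iInter fun A => isClosed_iInter fun A' => isClosed_iInter fun _ =>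
        isClosed_eq ((continuous_apply A).mul (continuous_apply A')) continuous_const
    · exact isClosed_eq (continuous_finsetSum _ fun A _ => continuous_apply A) continuous_const
  · rintro f ⟨h0, hs, -, h1⟩ A -
    refine ⟨h0 A, ?_⟩
    by_cases hA : c ∈ A.1
    · rw [← h1]
      exact Finset.single_le_sum (fun A _ => h0 A) (by simpa using hA)
    · rw [hs A hA]
      exact zero_le_one

theorem isClosed_davisOf (Δ : Building cs C) (R : Set C) : IsClosed (Δ.davisOf R) := by
  have : Δ.davisOf R = ⋂ A : Δ.SphericalResidue, ⋂ _ : ¬ A.1 ⊆ R, {p | p.1 A = 0} := by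
    ext p
    simp only [davisOf, Set.mem_iInter, Set.mem_ofPred_eq]
    exact forall_congr' fun A => not_imp_comm
  rw [this]
  exact isClosed_iInter fun A => isClosed_iInter fun _ =>
    isClosed_eq (Δ.continuous_coord A) continuous_const

theorem smul_davisOf (Δ : Building cs C) (g : Δ.typeAut) (R : Set C) :
    g • Δ.davisOf R = Δ.davisOf (g • R) := by
  ext p
  rw [Set.mem_smul_set_iff_inv_smul_mem]
  constructor
  · intro h A hA
    have h' := h (g⁻¹ • A) (by
      change p.1 (g⁻¹⁻¹ • g⁻¹ • A) ≠ 0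
      rwa [inv_inv, smul_inv_smul])
    exact Set.subset_smul_set_iff.2 h'
  · intro h A hA
    have hA' : p.1 (g⁻¹⁻¹ • A) ≠ 0 := hA
    rw [inv_inv] at hA'
    exact Set.smul_set_subset_smul_set_iff.1 (h (g • A) hA')

theorem smul_closedChamber (Δ : Building cs C) (g : Δ.typeAut) (c : C) :
    g • Δ.closedChamber c = Δ.closedChamber (g • c) := by
  ext p
  rw [Set.mem_smul_set_iff_inv_smul_mem]
  constructor
  · intro h A hA
    have h' := h (g⁻¹ • A) (by
      change p.1 (g⁻¹⁻¹ • g⁻¹ • A) ≠ 0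
      rwa [inv_inv, smul_inv_smul])
    have h'' := Set.mem_smul_set_iff_inv_smul_mem.1 h'
    rwa [inv_inv] at h''
  · intro h A hA
    have hA' : p.1 (g⁻¹⁻¹ • A) ≠ 0 := hA
    rw [inv_inv] at hA'
    exact Set.smul_mem_smul_set_iff.1 (h (g • A) hA')

/-! ### Finiteness of chamber orbits -/

/-- The chamber `c` as a spherical residue of empty type. -/
def chamberResidue (Δ : Building cs C) (c : C) : Δ.SphericalResidue :=
  ⟨{c}, ∅, c, by
    have h : cs.parabolic ∅ = ⊥ := by simp [CoxeterSystem.parabolic]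
    refine ⟨by rw [h]; infer_instance, ?_⟩
    ext d
    change d = c ↔ Δ.dist c d ∈ cs.parabolic ∅
    rw [h, Subgroup.mem_bot, Δ.dist_eq_one_iff, eq_comm]⟩

theorem chamberResidue_injective (Δ : Building cs C) : Function.Injective Δ.chamberResidue :=
  fun _ _ h => Set.singleton_injective (congrArg Subtype.val h)

theorem smul_chamberResidue (Δ : Building cs C) (g : Δ.typeAut) (c : C) :
    g • Δ.chamberResidue c = Δ.chamberResidue (g • c) :=
  Subtype.ext Set.smul_set_singleton

open Classical in
/-- The vertex of the Davis realization that belongs to a spherical residue. -/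
noncomputable def vertex (Δ : Building cs C) (A : Δ.SphericalResidue) : Δ.Davis :=
  ⟨Pi.single A 1, fun A' => by
      rw [Pi.single_apply]
      split_ifs <;> norm_num,
    (Set.finite_singleton A).subset Pi.support_single_subset,
    (Set.subsingleton_singleton.anti Pi.support_single_subset).isChain, by
      rw [finsum_eq_single _ A fun A' h => Pi.single_eq_of_ne h _, Pi.single_eq_same]⟩

theorem vertex_apply_ne_zero_iff (Δ : Building cs C) (A A' : Δ.SphericalResidue) :
    (Δ.vertex A).1 A' ≠ 0 ↔ A' = A := by
  classical
  simp [vertex, Pi.single_apply]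

theorem exists_coord_ne_zero (Δ : Building cs C) (p : Δ.Davis) : ∃ A, p.1 A ≠ 0 := by
  by_contra! h
  have h1 := p.2.2.2.2
  simp [h] at h1

/-- A compact subset of the Davis realization contains only finitely many vertices: each open
star contains just one. -/
theorem finite_vertex_mem (Δ : Building cs C) {K : Set Δ.Davis} (hK : IsCompact K) :
    {A | Δ.vertex A ∈ K}.Finite := by
  obtain ⟨t, ht⟩ := hK.elim_finite_subcover (fun A : Δ.SphericalResidue => {p | p.1 A ≠ 0})
    (fun A => isOpen_ne_fun (Δ.continuous_coord A) continuous_const)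
    (fun p _ => Set.mem_iUnion.2 (Δ.exists_coord_ne_zero p))
  refine t.finite_toSet.subset fun A hA => ?_
  obtain ⟨A', hA', h⟩ := Set.mem_iUnion₂.1 (ht hA)
  rwa [← (Δ.vertex_apply_ne_zero_iff A A').1 h]

/-- A group that acts cocompactly on the Davis realization has finitely many orbits of
chambers. -/
theorem exists_finite_chamber_reps (Δ : Building cs C) {G : Subgroup Δ.typeAut}
    (hG : ActsCocompactly G (Set.univ : Set Δ.Davis)) :
    ∃ F : Set C, F.Finite ∧ ∀ d, ∃ x ∈ F, ∃ g ∈ G, d = g • x := by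
  obtain ⟨-, K, -, hK, hU⟩ := hG
  refine ⟨{x | Δ.vertex (Δ.chamberResidue x) ∈ K},
    (Δ.finite_vertex_mem hK).preimage (f := Δ.chamberResidue)
      Δ.chamberResidue_injective.injOn, fun d => ?_⟩
  obtain ⟨g, hg, k, hk, hgk⟩ : ∃ g ∈ G, ∃ k ∈ K, g • k = Δ.vertex (Δ.chamberResidue d) := by
    have h := Set.mem_univ (Δ.vertex (Δ.chamberResidue d))
    rw [hU] at h
    obtain ⟨g, hg, h⟩ := Set.mem_iUnion₂.1 h
    exact ⟨g, hg, h⟩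
  refine ⟨g⁻¹ • d, ?_, g, hg, (smul_inv_smul g d).symm⟩
  have : k = Δ.vertex (Δ.chamberResidue (g⁻¹ • d)) := by
    classical
    rw [← inv_smul_eq_iff.2 hgk.symm, ← smul_chamberResidue]
    refine Subtype.ext (funext fun A => ?_)
    change (Pi.single (Δ.chamberResidue d) 1 : Δ.SphericalResidue → ℝ) (g⁻¹⁻¹ • A) =
      (Pi.single (g⁻¹ • Δ.chamberResidue d) 1 : Δ.SphericalResidue → ℝ) A
    simp only [Pi.single_apply, inv_inv, eq_inv_smul_iff]
  change Δ.vertex _ ∈ K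
  rwa [← this]

/-- The stabilizer of a residue in a group acting cocompactly on the Davis realization has
finitely many orbits of chambers in the residue. -/
theorem IsResidue.exists_finite_chamber_reps {Δ : Building cs C} {G : Subgroup Δ.typeAut}
    (hG : ActsCocompactly G (Set.univ : Set Δ.Davis)) {R : Set C} (hR : Δ.IsResidue R) :
    ∃ F ⊆ R, F.Finite ∧
      ∀ d ∈ R, ∃ x ∈ F, ∃ g ∈ G ⊓ MulAction.stabilizer Δ.typeAut R, d = g • x := by
  obtain ⟨F, hF, hrep⟩ := Δ.exists_finite_chamber_reps hG
  choose r hrF hr using hrep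
  -- The representatives in `F` may lie outside `R`; `F'` takes instead one chamber of `R` from each
  -- nonempty fibre of `r` on `R`.
  obtain ⟨F', hF'R, hbij⟩ := R.exists_subset_bijOn r
  have hfin : F'.Finite := Set.Finite.of_finite_image
    (hF.subset (Set.image_subset_iff.2 fun d _ => hrF d)) hbij.injOn
  refine ⟨F', hF'R, hfin, fun d hd => ?_⟩
  obtain ⟨x, hx, hxd⟩ := hbij.surjOn (Set.mem_image_of_mem r hd)
  obtain ⟨g, hg, hgd⟩ := hr d
  obtain ⟨g', hg', hgx⟩ := hr x
  have hdx : d = (g * g'⁻¹) • x := by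
    rw [mul_smul, eq_comm, inv_smul_eq_iff.2 hgx, hxd, ← hgd]
  exact ⟨x, hx, g * g'⁻¹, ⟨G.mul_mem hg (G.inv_mem hg'), hR.smul_eq (hF'R hx) (hdx ▸ hd)⟩, hdx⟩

/-! ### From finitely many orbits to cocompactness -/

/-- A point of the realization of `R` lies in a closed chamber belonging to a chamber of `R`. -/
theorem exists_mem_closedChamber_of_mem_davisOf (Δ : Building cs C) {R : Set C} {p : Δ.Davis}
    (hp : p ∈ Δ.davisOf R) : ∃ d ∈ R, p ∈ Δ.closedChamber d := by
  -- `A` is the least element of the supporting chain, so each chamber of `A` lies in every residue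
  -- of the support.
  obtain ⟨A, hA, hmin⟩ := Set.exists_min_image p.1.support
    (fun A => {A' ∈ p.1.support | A'.1 ⊆ A.1}.ncard) p.2.2.1 (Δ.exists_coord_ne_zero p)
  obtain ⟨J, d, -, hJ⟩ := A.2
  have hd : d ∈ A.1 := by
    rw [hJ]
    exact Δ.mem_residue_self J d
  refine ⟨d, hp A hA hd, fun A' hA' => ?_⟩
  have hle : A.1 ⊆ A'.1 := by
    by_contra hnot
    have hsub : A'.1 ⊆ A.1 :=
      (p.2.2.2.1 hA hA' fun h => hnot (h ▸ subset_rfl)).resolve_left hnot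
    refine (hmin A' hA').not_gt (Set.ncard_lt_ncard ⟨fun A'' h => ⟨h.1, h.2.trans hsub⟩, ?_⟩
      (p.2.2.1.subset fun _ h => h.1))
    exact fun h => hnot (h ⟨hA, subset_rfl⟩).2
  exact hle hd

/-- A stable union of closed pieces of closed chambers, indexed by the chambers of a set with
finitely many orbits, is acted on cocompactly. -/
theorem actsCocompactly_of_reps [Finite B] (Δ : Building cs C) {H : Subgroup Δ.typeAut}
    {R F : Set C} (hFR : F ⊆ R) (hF : F.Finite) (hrep : ∀ d ∈ R, ∃ x ∈ F, ∃ g ∈ H, d = g • x)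
    {Y Z : Set Δ.Davis} (hY : ∀ h ∈ H, h • Y = Y) (hZ : IsClosed Z) (hZH : ∀ h ∈ H, h • Z = Z)
    (hYZ : Y = (⋃ d ∈ R, Δ.closedChamber d) ∩ Z) : ActsCocompactly H Y := by
  have hsub : (⋃ x ∈ F, Δ.closedChamber x) ∩ Z ⊆ Y := by
    rw [hYZ]
    exact Set.inter_subset_inter_left _ (Set.biUnion_subset_biUnion_left hFR)
  refine ⟨hY, _, hsub, (hF.isCompact_biUnion fun x _ => Δ.isCompact_closedChamber x).inter_right hZ,
    Set.Subset.antisymm ?_ (Set.iUnion₂_subset fun h hh => ?_)⟩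
  · intro p hp
    rw [hYZ] at hp
    obtain ⟨d, hd, hpd⟩ := Set.mem_iUnion₂.1 hp.1
    obtain ⟨x, hx, g, hg, rfl⟩ := hrep d hd
    refine Set.mem_iUnion₂.2 ⟨g, hg, ?_⟩
    rw [Set.smul_set_inter, hZH g hg]
    refine ⟨?_, hp.2⟩
    rw [← smul_closedChamber] at hpd
    exact Set.smul_set_mono (Set.subset_biUnion_of_mem hx) hpd
  · exact (Set.smul_set_mono hsub).trans (hY h hh).subset

theorem smul_iUnion_closedChamber (Δ : Building cs C) (g : Δ.typeAut) (R : Set C) :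
    g • (⋃ d ∈ R, Δ.closedChamber d) = ⋃ d ∈ g • R, Δ.closedChamber d := by
  simp only [Set.smul_set_iUnion, smul_closedChamber]
  rw [← Set.image_smul, Set.biUnion_image]

end Building

theorem mainTheorem3 {B W C : Type*} [Finite B] [Group W] [Infinite W]
    {M : CoxeterMatrix B} (cs : CoxeterSystem M W)
    (Δ : Building cs C) (hΔ : Δ.IsLocallyFinite)
    (G : Subgroup Δ.typeAut)
    (hG : ActsCocompactly G (Set.univ : Set Δ.Davis))
    (c : C) (R : Set C) (hR : Δ.IsResidue R) (hc : c ∈ R) :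
    ActsCocompactly (G ⊓ MulAction.stabilizer Δ.typeAut R) (Δ.davisOf R) ∧
      ActsCocompactly (G ⊓ MulAction.stabilizer Δ.typeAut R)
        (⋃ d ∈ R, Δ.closedChamber d) := by
  obtain ⟨F, hFR, hF, hrep⟩ := hR.exists_finite_chamber_reps hG
  have hstab : ∀ h ∈ G ⊓ MulAction.stabilizer Δ.typeAut R, h • R = R := fun h hh => hh.2
  have hdavis : ∀ h ∈ G ⊓ MulAction.stabilizer Δ.typeAut R, h • Δ.davisOf R = Δ.davisOf R :=
    fun h hh => by rw [Δ.smul_davisOf, hstab h hh]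
  constructor
  · refine Δ.actsCocompactly_of_reps hFR hF hrep hdavis (Δ.isClosed_davisOf R) hdavis ?_
    refine (Set.inter_eq_right.2 fun p hp => ?_).symm
    obtain ⟨d, hd, hpd⟩ := Δ.exists_mem_closedChamber_of_mem_davisOf hp
    exact Set.mem_iUnion₂.2 ⟨d, hd, hpd⟩
  · refine Δ.actsCocompactly_of_reps hFR hF hrep (fun h hh => ?_) isClosed_univ
      (fun _ _ => Set.smul_set_univ) (Set.inter_univ _).symm
    rw [Δ.smul_iUnion_closedChamber, hstab h hh]
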